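/- Let $T$ be a finite set of $n$ targets, $D$ a finite set of $k\ge 1$ depots (disjoint from $T$), and let $C_1,\dots,C_m$ be a partition of $T$ into non-empty clusters. Let $G=(V,E)$ be the undirected graph with $V=T\cup D$ in which any two distinct vertices are adjacent unless both are depots. For $S\subseteq V$ put $\gamma(S)=\{(i,j)\in E: i,j\in S\}$ and $\delta(S)=\{(i,j)\in E: i\in S,\ j\notin S\}$, with $\delta(i)=\delta(\{i\})$; for disjoint $A,B\subseteq V$ put $(A:B)=\{(i,j)\in E: i\in A,\ j\in B\}$; and for $F\subseteq E$ put $x(F)=\sum_{e\in F}x_e$. A feasible solution of the generalized multiple depot traveling salesmen problem (GMDTSP) is a vector $(\mathbf x,\mathbf y)\in\mathbb R^{E}\times\mathbb R^{T}$ that satisfies \begin{align*} & x(\delta(i))=2y_i && \forall\, i\in T,\\ & \sum_{i\in C_h}y_i\ge 1 && \forall\, h\in\{1,\dots,m\},\\ & x(\delta(S))\ge 2y_i && \forall\, S\subseteq T,\ i\in S,\\ & x(D':\{j\})+3x_{jk}+x(\{k\}:D\setminus D')\le 2(y_j+y_k) && \forall\, j,k\in T,\ j\ne k,\ D'\subseteq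 D,\\ & x(D':\{j\})+2x(\gamma(S\cup\{j,k\}))+x(\{k\}:D\setminus D')\le \sum_{v\in S}2y_v+2(y_j+y_k)-y_i && \forall\, j,k\in T,\ j\ne k,\ S\subseteq T\setminus\{j,k\},\ i\in S,\ D'\subseteq D,\\ & x_e\in\{0,1\}\ \ \forall\, e\in\gamma(T),\qquad x_e\in\{0,1,2\}\ \ \forall\, e\in(D:T),\qquad y_i\in\{0,1\}\ \ \forall\, i\in T. \end{align*} Let the GMDTSP polytope $P\subseteq\mathbb R^{E}\times\mathbb R^{T}$ be the convex hull of the feasible solutions, and let $W$ be the set of targets whose cluster is a singleton. Then $P$ is non-empty and its dimension (the dimension of its affine hull) is $$\dim(P)=\binom n2+nk-|W| .$$ -/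

import Mathlib

namespace GMDTSP

/-- The graph on the vertex set `V = T ∪ D` (targets `Sum.inl t`, depots `Sum.inr d`): any two
distinct vertices are adjacent, except that two depots never are. -/
def graph (T D : Type*) : SimpleGraph (T ⊕ D) where
  Adj u v := u ≠ v ∧ (u.isLeft ∨ v.isLeft)
  symm := ⟨fun _ _ h => ⟨h.1.symm, h.2.symm⟩⟩
  loopless := ⟨fun _ h => h.1 rfl⟩

/-- The edge set `E`, as a type. -/
abbrev Edge (T D : Type*) : Type _ := (graph T D).edgeSet

/-- The edge joining two distinct targets. -/
def targetEdge {T : Type*} (D : Type*) (j k : T) (h : j ≠ k) : Edge T D :=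
  ⟨s(Sum.inl j, Sum.inl k), by simp [graph, h]⟩

/-- A set of targets, as a set of vertices. -/
def targets {T : Type*} (D : Type*) (S : Set T) : Set (T ⊕ D) := Sum.inl '' S

/-- A set of depots, as a set of vertices. -/
def depots (T : Type*) {D : Type*} (S : Set D) : Set (T ⊕ D) := Sum.inr '' S

/-- `γ(S)`: the edges with both endpoints in `S`. -/
def inner {T D : Type*} (S : Set (T ⊕ D)) : Set (Edge T D) :=
  {e | ∃ i ∈ S, ∃ j ∈ S, e.1 = s(i, j)}

/-- `δ(S)`: the edges with exactly one endpoint in `S`. -/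
def cut {T D : Type*} (S : Set (T ⊕ D)) : Set (Edge T D) :=
  {e | ∃ i ∈ S, ∃ j ∉ S, e.1 = s(i, j)}

/-- `(A : B)`: the edges with one endpoint in `A` and the other in `B`. -/
def between {T D : Type*} (A B : Set (T ⊕ D)) : Set (Edge T D) :=
  {e | ∃ i ∈ A, ∃ j ∈ B, e.1 = s(i, j)}

open Classical in
/-- `x(A) = ∑_{e ∈ A} x_e` for a set `A` of edges. -/
noncomputable def edgeSum {T D : Type*} [Fintype T] [Fintype D]
    (x : Edge T D → ℝ) (A : Set (Edge T D)) : ℝ :=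
  ∑ e ∈ A.toFinset, x e

/-- `(x, y)` is a feasible solution of the integer programming formulation of the generalized
multiple depot traveling salesmen problem with targets `T`, depots `D` and clusters `C`. -/
structure IsFeasible {T D : Type*} [Fintype T] [DecidableEq T] [Fintype D]
    (C : Finpartition (Finset.univ : Finset T)) (x : Edge T D → ℝ) (y : T → ℝ) : Prop where
  /-- degree equations: `x(δ(i)) = 2 y_i` -/
  degree : ∀ i : T, edgeSum x (cut (targets D {i})) = 2 * y i
  /-- every cluster contains a visited target -/
  cluster : ∀ K ∈ C.parts, 1 ≤ ∑ i ∈ K, y i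
  /-- subtour elimination: `x(δ(S)) ≥ 2 y_i` -/
  subtour : ∀ (S : Finset T) (i : T), i ∈ S → 2 * y i ≤ edgeSum x (cut (targets D (S : Set T)))
  /-- elimination of the paths between two depots through exactly two targets -/
  fourPath : ∀ (j k : T) (hjk : j ≠ k) (D' : Set D),
    edgeSum x (between (depots T D') (targets D {j})) + 3 * x (targetEdge D j k hjk)
      + edgeSum x (between (targets D {k}) (depots T D'ᶜ)) ≤ 2 * (y j + y k)
  /-- elimination of the paths between two depots through at least three targets -/
  path : ∀ (j k : T), j ≠ k → ∀ (S : Finset T), j ∉ S → k ∉ S → ∀ i ∈ S, ∀ D' : Set D,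
    edgeSum x (between (depots T D') (targets D {j}))
      + 2 * edgeSum x (inner (targets D ((S : Set T) ∪ {j, k})))
      + edgeSum x (between (targets D {k}) (depots T D'ᶜ))
      ≤ (∑ v ∈ S, 2 * y v) + 2 * (y j + y k) - y i
  /-- `x_e ∈ {0, 1}` for the edges between targets -/
  integral_target : ∀ e ∈ (inner (targets D Set.univ) : Set (Edge T D)), x e = 0 ∨ x e = 1
  /-- `x_e ∈ {0, 1, 2}` for the edges between a depot and a target -/
  integral_depot : ∀ e ∈ (between (depots T Set.univ) (targets D Set.univ) : Set (Edge T D)),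
    x e = 0 ∨ x e = 1 ∨ x e = 2
  /-- `y_i ∈ {0, 1}` -/
  integral_visit : ∀ i : T, y i = 0 ∨ y i = 1

/-- The polytope `P` in `ℝ^E × ℝ^T`: the convex hull of the feasible solutions. -/
def polytope {T : Type*} (D : Type*) [Fintype T] [DecidableEq T] [Fintype D]
    (C : Finpartition (Finset.univ : Finset T)) : Set ((Edge T D → ℝ) × (T → ℝ)) :=
  convexHull ℝ {p | IsFeasible C p.1 p.2}

/-- `W`: the set of targets whose cluster is a singleton. -/
def singletonTargets {T : Type*} [Fintype T] [DecidableEq T]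
    (C : Finpartition (Finset.univ : Finset T)) : Finset T :=
  Finset.univ.filter fun v => (C.part v).card = 1

end GMDTSP

namespace GMDTSP

/-! The direction of the affine hull of P is the kernel of `equations`: the homogeneous degree
equations, together with y_w = 0 for w ∈ W. This map is onto ℝ^T × ℝ^W, so its kernel has dimension
|E| + n - (n + |W|) = |E| - |W|. One inclusion holds because a singleton cluster forces its target
to be visited (`IsFeasible.visit_eq_one`). Conversely, start from the solution that serves every
target by a round trip from a fixed depot a. Moving one round trip to another depot, merging two
round trips into one tour, or dropping a target outside W keeps it feasible (`isFeasible_star`,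
`isFeasible_merge`). The resulting differences span the kernel (`exchange_mem_vectorSpan`,
`visit_mem_vectorSpan`, `ker_equations_le`). -/

/-- The edge joining a depot and a target. -/
def depotEdge {T D : Type*} (d : D) (t : T) : Edge T D :=
  ⟨s(Sum.inr d, Sum.inl t), by simp [graph]⟩

/-! ### Incidence of edges with cuts, inner sets and depot-target sets -/

section Membership

variable {T D : Type*}

theorem depotEdge_inj {d d' : D} {t t' : T} :
    depotEdge d t = depotEdge d' t' ↔ d = d' ∧ t = t' := by
  rw [← Subtype.val_inj]
  simp [depotEdge]

theorem targetEdge_ne_depotEdge {j k : T} (h : j ≠ k) (d : D) (t : T) :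
    targetEdge D j k h ≠ depotEdge d t := by
  rw [ne_eq, ← Subtype.val_inj]
  simp [depotEdge, targetEdge]

theorem depotEdge_ne_targetEdge {j k : T} (h : j ≠ k) (d : D) (t : T) :
    depotEdge d t ≠ targetEdge D j k h :=
  (targetEdge_ne_depotEdge h d t).symm

theorem targetEdge_inj {j k j' k' : T} (h : j ≠ k) (h' : j' ≠ k') :
    targetEdge D j k h = targetEdge D j' k' h' ↔ j = j' ∧ k = k' ∨ j = k' ∧ k = j' := by
  rw [← Subtype.val_inj]
  simp [targetEdge]

theorem Edge.cases (e : Edge T D) :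
    (∃ j k, ∃ h : j ≠ k, e = targetEdge D j k h) ∨ ∃ d t, e = depotEdge d t := by
  obtain ⟨e, he⟩ := e
  induction e with | _ u v =>
  rcases u with j | d <;> rcases v with k | d'
  · exact .inl ⟨j, k, by simpa [graph] using he, rfl⟩
  · exact .inr ⟨d', j, Subtype.ext Sym2.eq_swap⟩
  · exact .inr ⟨d, k, rfl⟩
  · simp [graph] at he

theorem depotEdge_mem_cut {d : D} {t : T} {S : Set T} :
    depotEdge d t ∈ cut (targets D S) ↔ t ∈ S := by
  simp [depotEdge, cut, targets]

theorem targetEdge_mem_cut {j k : T} (h : j ≠ k) {S : Set T} :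
    targetEdge D j k h ∈ cut (targets D S) ↔ j ∈ S ∧ k ∉ S ∨ k ∈ S ∧ j ∉ S := by
  simp only [targetEdge, cut, targets, Set.mem_ofPred_eq]
  constructor
  · rintro ⟨_, ⟨a, ha, rfl⟩, v, hv, he⟩
    rw [Sym2.eq_iff] at he
    rcases he with ⟨h1, rfl⟩ | ⟨rfl, h1⟩ <;> cases h1 <;> simp_all
  · rintro (⟨h1, h2⟩ | ⟨h1, h2⟩)
    · exact ⟨_, ⟨j, h1, rfl⟩, Sum.inl k, by simpa using h2, rfl⟩
    · exact ⟨_, ⟨k, h1, rfl⟩, Sum.inl j, by simpa using h2, Sym2.eq_swap⟩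

theorem depotEdge_mem_between {d : D} {t : T} {A : Set D} {S : Set T} :
    depotEdge d t ∈ between (depots T A) (targets D S) ↔ d ∈ A ∧ t ∈ S := by
  simp [depotEdge, between, targets, depots]

theorem between_comm (A B : Set (T ⊕ D)) : between A B = between B A := by
  ext e
  simp only [between, Set.mem_ofPred_eq]
  constructor <;> rintro ⟨i, hi, j, hj, h⟩ <;> exact ⟨j, hj, i, hi, h.trans Sym2.eq_swap⟩

theorem targetEdge_notMem_between {j k : T} (h : j ≠ k) {A : Set D} {S : Set T} :
    targetEdge D j k h ∉ between (depots T A) (targets D S) := by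
  simp [targetEdge, between, targets, depots]

theorem depotEdge_notMem_inner {d : D} {t : T} {S : Set T} :
    depotEdge d t ∉ inner (targets D S) := by
  simp [depotEdge, inner, targets]

end Membership

/-! ### Linearity of edge sums and the number of edges -/

section EdgeSum

variable {T D : Type*} [Fintype T] [Fintype D]

open Classical in
theorem edgeSum_eq_sum_ite (x : Edge T D → ℝ) (A : Set (Edge T D)) :
    edgeSum x A = ∑ e, if e ∈ A then x e else 0 := by
  rw [edgeSum, ← Finset.sum_filter]
  congr 1
  ext
  simp

theorem edgeSum_add (x x' : Edge T D → ℝ) (A : Set (Edge T D)) :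
    edgeSum (x + x') A = edgeSum x A + edgeSum x' A := by
  simp [edgeSum, Finset.sum_add_distrib]

theorem edgeSum_sub (x x' : Edge T D → ℝ) (A : Set (Edge T D)) :
    edgeSum (x - x') A = edgeSum x A - edgeSum x' A := by
  simp [edgeSum, Finset.sum_sub_distrib]

theorem edgeSum_smul (c : ℝ) (x : Edge T D → ℝ) (A : Set (Edge T D)) :
    edgeSum (c • x) A = c * edgeSum x A := by
  simp [edgeSum, Finset.mul_sum]

theorem edgeSum_sum {ι : Type*} (s : Finset ι) (x : ι → Edge T D → ℝ) (A : Set (Edge T D)) :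
    edgeSum (∑ i ∈ s, x i) A = ∑ i ∈ s, edgeSum (x i) A := by
  simp only [edgeSum, Finset.sum_apply]
  exact Finset.sum_comm

open Classical in
theorem edgeSum_single (e : Edge T D) (c : ℝ) (A : Set (Edge T D)) :
    edgeSum (Pi.single e c) A = if e ∈ A then c else 0 := by
  rw [edgeSum_eq_sum_ite, Finset.sum_eq_single e]
  · simp
  · intro b _ hb
    simp [hb]
  · simp

open Classical in
theorem card_edge : Fintype.card (Edge T D) =
    (Fintype.card T).choose 2 + Fintype.card T * Fintype.card D := by
  let f : {a : Sym2 T // ¬ a.IsDiag} ⊕ T × D → Edge T D := Sum.elim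
    (fun a => ⟨a.1.map Sum.inl, by
      obtain ⟨a, ha⟩ := a
      induction a with | _ j k => simpa [graph] using ha⟩)
    (fun p => depotEdge p.2 p.1)
  have hf : Function.Bijective f := by
    constructor
    · rintro (⟨a, ha⟩ | ⟨t, d⟩) (⟨b, hb⟩ | ⟨t', d'⟩) h
      · have := Sym2.map.injective Sum.inl_injective (congrArg Subtype.val h)
        simp_all
      · induction a with | _ j k =>
        exact absurd h (targetEdge_ne_depotEdge (by simpa using ha) d' t')
      · induction b with | _ j k =>
        exact absurd h (depotEdge_ne_targetEdge (by simpa using hb) d t)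
      · obtain ⟨rfl, rfl⟩ := depotEdge_inj.1 h
        rfl
    · intro e
      obtain ⟨j, k, h, rfl⟩ | ⟨d, t, rfl⟩ := e.cases
      · exact ⟨.inl ⟨s(j, k), by simpa using h⟩, rfl⟩
      · exact ⟨.inr (t, d), rfl⟩
  rw [← Fintype.card_of_bijective hf, Fintype.card_sum, Fintype.card_prod,
    Sym2.card_subtype_not_diag]

end EdgeSum

/-! ### Feasible solutions: round trips and one merged tour -/

section Solutions

variable {T D : Type*} [Fintype T]

open Classical in
/-- The solution in which every target `t` visited by `y` is joined to the depot `d t` by a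
doubled edge. -/
noncomputable def star (d : T → D) (y : T → ℝ) : Edge T D → ℝ :=
  ∑ t, Pi.single (depotEdge (d t) t) (2 * y t)

theorem star_targetEdge (d : T → D) (y : T → ℝ) {j k : T} (h : j ≠ k) :
    star d y (targetEdge D j k h) = 0 := by
  simp [star, targetEdge_ne_depotEdge]

open Classical in
theorem star_depotEdge (d : T → D) (y : T → ℝ) (a : D) (t : T) :
    star d y (depotEdge a t) = if a = d t then 2 * y t else 0 := by
  simp [star, Pi.single_apply, depotEdge_inj, and_comm, ite_and]

variable [Fintype D]

open Classical in
theorem edgeSum_star (d : T → D) (y : T → ℝ) (A : Set (Edge T D)) :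
    edgeSum (star d y) A = ∑ t, if depotEdge (d t) t ∈ A then 2 * y t else 0 := by
  simp only [star, edgeSum_sum, edgeSum_single]

theorem edgeSum_star_cut (d : T → D) (y : T → ℝ) (S : Finset T) :
    edgeSum (star d y) (cut (targets D (S : Set T))) = ∑ t ∈ S, 2 * y t := by
  classical
  simp [edgeSum_star, depotEdge_mem_cut]

theorem edgeSum_star_cut_singleton (d : T → D) (y : T → ℝ) (i : T) :
    edgeSum (star d y) (cut (targets D {i})) = 2 * y i := by
  simpa using edgeSum_star_cut d y {i}

theorem edgeSum_star_inner (d : T → D) (y : T → ℝ) (S : Set T) :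
    edgeSum (star d y) (inner (targets D S)) = 0 := by
  simp [edgeSum_star, depotEdge_notMem_inner]

open Classical in
theorem edgeSum_star_between (d : T → D) (y : T → ℝ) (A : Set D) (j : T) :
    edgeSum (star d y) (between (depots T A) (targets D {j})) =
      if d j ∈ A then 2 * y j else 0 := by
  simp only [edgeSum_star, depotEdge_mem_between, Set.mem_singleton_iff, and_comm, ite_and]
  simp

open Classical in
theorem edgeSum_star_between' (d : T → D) (y : T → ℝ) (A : Set D) (j : T) :
    edgeSum (star d y) (between (targets D {j}) (depots T A)) =
      if d j ∈ A then 2 * y j else 0 := by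
  rw [between_comm, edgeSum_star_between]

open Classical in
/-- The edge vector that replaces, at a fixed depot `a`, the two round trips to `j` and `k`
by one tour through both. -/
noncomputable def mergeVector (a : D) (j k : T) (h : j ≠ k) : Edge T D → ℝ :=
  Pi.single (targetEdge D j k h) 1 - Pi.single (depotEdge a j) 1 - Pi.single (depotEdge a k) 1

open Classical in
theorem edgeSum_mergeVector (a : D) (j k : T) (h : j ≠ k) (A : Set (Edge T D)) :
    edgeSum (mergeVector a j k h) A = (if targetEdge D j k h ∈ A then 1 else 0)
      - (if depotEdge a j ∈ A then 1 else 0) - (if depotEdge a k ∈ A then 1 else 0) := by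
  simp only [mergeVector, edgeSum_sub, edgeSum_single]

variable [DecidableEq T] {C : Finpartition (Finset.univ : Finset T)}

/-- No edge between targets is used, and each target sends at most 2 y_t to any set of depots, so
both path constraints hold; in the longer one, the sum over S absorbs -y_i. -/
theorem isFeasible_star (d : T → D) {y : T → ℝ} (hy : ∀ i, y i = 0 ∨ y i = 1)
    (hC : ∀ K ∈ C.parts, 1 ≤ ∑ i ∈ K, y i) : IsFeasible C (star d y) y := by
  classical
  have hy0 : ∀ i, 0 ≤ y i := fun i => by rcases hy i with h | h <;> simp [h]
  have hite : ∀ (A : Set D) (j : T), (if d j ∈ A then 2 * y j else 0) ≤ 2 * y j := fun A j => by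
    split_ifs <;> linarith [hy0 j]
  refine ⟨edgeSum_star_cut_singleton d y, hC, fun S i hi => ?_, fun j k hjk A => ?_,
    fun j k hjk S hj hk i hi A => ?_, fun e he => ?_, fun e he => ?_, hy⟩
  · rw [edgeSum_star_cut]
    exact Finset.single_le_sum (f := fun t => 2 * y t) (fun t _ => by linarith [hy0 t]) hi
  · rw [edgeSum_star_between, edgeSum_star_between', star_targetEdge]
    linarith [hite A j, hite Aᶜ k]
  · rw [edgeSum_star_between, edgeSum_star_between', edgeSum_star_inner]
    have := Finset.single_le_sum (f := fun t => 2 * y t) (fun t _ => by linarith [hy0 t]) hi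
    linarith [hite A j, hite Aᶜ k, hy0 i]
  · obtain ⟨j, k, h, rfl⟩ | ⟨a, t, rfl⟩ := e.cases
    · exact .inl (star_targetEdge d y h)
    · exact absurd he depotEdge_notMem_inner
  · obtain ⟨j, k, h, rfl⟩ | ⟨a, t, rfl⟩ := e.cases
    · exact absurd he (targetEdge_notMem_between h)
    · rw [star_depotEdge]
      by_cases ha : a = d t <;> rcases hy t with h | h <;> simp [h, ha]

theorem isFeasible_star_one (d : T → D) : IsFeasible C (star d 1) 1 := by
  refine isFeasible_star d (by simp) fun K hK => ?_
  simpa using (C.nonempty_of_mem_parts hK).card_pos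

theorem isFeasible_star_update (d : T → D) {t : T} (ht : t ∉ singletonTargets C) :
    IsFeasible C (star d (Function.update 1 t 0)) (Function.update 1 t 0) := by
  refine isFeasible_star d (fun i => ?_) fun K hK => ?_
  · by_cases h : i = t <;> simp [h]
  · have hne : ∃ s ∈ K, s ≠ t := by
      by_contra! h
      have hKt : K = {t} :=
        (Finset.eq_singleton_iff_nonempty_unique_mem).2 ⟨C.nonempty_of_mem_parts hK, h⟩
      apply ht
      have : C.part t = K := C.part_eq_of_mem hK (by simp [hKt])
      simp [singletonTargets, this, hKt]
    obtain ⟨s, hs, hst⟩ := hne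
    have := Finset.single_le_sum (f := (Function.update 1 t 0 : T → ℝ))
      (fun i _ => by by_cases h : i = t <;> simp [h]) hs
    simpa [hst] using this

theorem isFeasible_merge (a : D) (j k : T) (h : j ≠ k) :
    IsFeasible C (star (fun _ => a) 1 + mergeVector a j k h) 1 := by
  classical
  have hs : IsFeasible C (star (fun _ : T => a) 1) 1 := isFeasible_star_one _
  have hb (A : Set D) (i : T) : edgeSum (star (fun _ => a) 1 + mergeVector a j k h)
      (between (depots T A) (targets D {i})) =
      if a ∈ A then 2 - (if j = i then 1 else 0) - (if k = i then 1 else 0) else 0 := by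
    rw [edgeSum_add, edgeSum_star_between, edgeSum_mergeVector]
    by_cases hA : a ∈ A <;> simp [hA, depotEdge_mem_between, targetEdge_notMem_between]
    ring
  -- All depot edges in use end at a, which lies in only one of A and its complement, so only one of
  -- the two sums can be nonzero.
  have hsum (A : Set D) (i l : T) : edgeSum (star (fun _ => a) 1 + mergeVector a j k h)
        (between (depots T A) (targets D {i})) +
      edgeSum (star (fun _ => a) 1 + mergeVector a j k h)
        (between (targets D {l}) (depots T Aᶜ)) ≤ 2 := by
    rw [between_comm (targets D {l}), hb, hb]
    by_cases hA : a ∈ A <;> simp only [hA, Set.mem_compl_iff, not_true, not_false_iff, if_true,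
      if_false] <;> split_ifs <;> norm_num
  refine ⟨fun i => ?_, hs.cluster, fun S i hi => ?_, fun l m hlm A => ?_,
    fun l m hlm S hl hm i hi A => ?_, fun e he => ?_, fun e he => ?_, fun _ => .inr rfl⟩
  · rw [edgeSum_add, hs.degree, edgeSum_mergeVector]
    simp only [targetEdge_mem_cut, depotEdge_mem_cut, Set.mem_singleton_iff]
    grind
  · rw [edgeSum_add, edgeSum_star_cut, edgeSum_mergeVector]
    simp only [targetEdge_mem_cut, depotEdge_mem_cut, Finset.mem_coe, Pi.one_apply]
    have h1 : 1 ≤ S.card := Finset.card_pos.2 ⟨i, hi⟩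
    -- The merge lowers the cut value 2|S| only when S contains both j and k, and then by 2.
    have h2 : j ∈ S → k ∈ S → 2 ≤ S.card := fun hj hk =>
      Finset.one_lt_card.2 ⟨j, hj, k, hk, h⟩
    have h1' : (1 : ℝ) ≤ S.card := by exact_mod_cast h1
    have h2' : j ∈ S → k ∈ S → (2 : ℝ) ≤ S.card := fun hj hk => by exact_mod_cast h2 hj hk
    simp only [Finset.sum_const, nsmul_eq_mul]
    by_cases hj : j ∈ S <;> by_cases hk : k ∈ S <;> simp only [hj, hk, not_true, not_false_iff,
      and_true, and_false, or_true, or_false, if_true, if_false] <;>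
      first | linarith [h2' hj hk] | linarith
  · have key := hsum A l m
    have hx : (star (fun _ => a) 1 + mergeVector a j k h : Edge T D → ℝ) (targetEdge D l m hlm) =
        if j = l ∧ k = m ∨ j = m ∧ k = l then 1 else 0 := by
      simp [star_targetEdge, mergeVector, Pi.single_apply, targetEdge_ne_depotEdge,
        targetEdge_inj]
      grind
    rw [hx]
    -- On the merged edge the term 3 x_{jk} leaves room for only 1 from the depot edges; this holds
    -- since j and k each keep a single edge to a.
    split_ifs with hc
    · have : edgeSum (star (fun _ => a) 1 + mergeVector a j k h)
            (between (depots T A) (targets D {l})) +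
          edgeSum (star (fun _ => a) 1 + mergeVector a j k h)
            (between (targets D {m}) (depots T Aᶜ)) ≤ 1 := by
        rw [between_comm (targets D {m}), hb, hb]
        by_cases hA : a ∈ A <;> simp only [hA, Set.mem_compl_iff, not_true, not_false_iff,
          if_true, if_false] <;> grind
      simp only [Pi.one_apply]
      linarith
    · simp only [Pi.one_apply]
      linarith
  · have key := hsum A l m
    have hin (U : Set T) : edgeSum (star (fun _ => a) 1 + mergeVector a j k h)
        (inner (targets D U)) ≤ 1 := by
      rw [edgeSum_add, edgeSum_star_inner, edgeSum_mergeVector]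
      simp only [depotEdge_notMem_inner, if_false]
      split_ifs <;> norm_num
    have h1 : (1 : ℝ) ≤ S.card := by exact_mod_cast Finset.card_pos.2 ⟨i, hi⟩
    simp only [Pi.one_apply, Finset.sum_const, nsmul_eq_mul]
    linarith [hin ((S : Set T) ∪ {l, m})]
  · obtain ⟨l, m, hlm, rfl⟩ | ⟨b, t, rfl⟩ := e.cases
    · simp [star_targetEdge, mergeVector, Pi.single_apply, targetEdge_ne_depotEdge, em']
    · exact absurd he depotEdge_notMem_inner
  · obtain ⟨l, m, hlm, rfl⟩ | ⟨b, t, rfl⟩ := e.cases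
    · exact absurd he (targetEdge_notMem_between hlm)
    · simp only [Pi.add_apply, star_depotEdge, mergeVector, Pi.sub_apply, Pi.single_apply,
        depotEdge_ne_targetEdge, depotEdge_inj, Pi.one_apply, if_false]
      grind

end Solutions

/-! ### The affine hull and its dimension -/

section Dimension

variable {T D : Type*} [Fintype T] [DecidableEq T] [Fintype D]

/-- The linear map whose kernel is the direction of the affine hull of the polytope: the degree
equations, and the visits of the targets in singleton clusters. -/
noncomputable def equations (D : Type*) [Fintype D]
    (C : Finpartition (Finset.univ : Finset T)) :
    ((Edge T D → ℝ) × (T → ℝ)) →ₗ[ℝ] (T → ℝ) × (singletonTargets C → ℝ) where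
  toFun p := (fun i => edgeSum p.1 (cut (targets D {i})) - 2 * p.2 i, fun w => p.2 w)
  map_add' p q := by
    ext i
    · simp only [Prod.fst_add, Prod.snd_add, edgeSum_add, Pi.add_apply]
      ring
    · simp
  map_smul' c p := by
    ext i
    · simp only [Prod.smul_fst, Prod.smul_snd, edgeSum_smul, Pi.smul_apply, smul_eq_mul,
        RingHom.id_apply]
      ring
    · simp

variable {C : Finpartition (Finset.univ : Finset T)}

theorem equations_surjective [Nonempty D] : Function.Surjective (equations D C) := by
  classical
  obtain ⟨a⟩ := ‹Nonempty D›
  rintro ⟨u, v⟩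
  let y : T → ℝ := fun t => if h : t ∈ singletonTargets C then v ⟨t, h⟩ else 0
  -- The star has degree twice its weight, so this weight leaves exactly u t after 2 y t is
  -- subtracted.
  refine ⟨(star (fun _ => a) (fun t => u t / 2 + y t), y), ?_⟩
  ext i
  · simp only [equations, LinearMap.coe_mk, AddHom.coe_mk, edgeSum_star_cut_singleton]
    ring
  · simp [equations, y]

open Classical in
theorem finrank_ker_equations [Nonempty D] :
    Module.finrank ℝ (LinearMap.ker (equations D C)) + (singletonTargets C).card =
      Fintype.card (Edge T D) := by
  have h := (equations D C).finrank_range_add_finrank_ker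
  rw [LinearMap.range_eq_top.2 equations_surjective, finrank_top] at h
  simp only [Module.finrank_prod, Module.finrank_fintype_fun_eq_card, Fintype.card_coe] at h
  omega

theorem IsFeasible.visit_eq_one {x : Edge T D → ℝ} {y : T → ℝ} (h : IsFeasible C x y) {w : T}
    (hw : w ∈ singletonTargets C) : y w = 1 := by
  have hc : (C.part w).card = 1 := by simpa [singletonTargets] using hw
  obtain ⟨v, hv⟩ := Finset.card_eq_one.1 hc
  have hwv : w = v := by
    have : w ∈ C.part w := C.mem_part (Finset.mem_univ w)
    simpa [hv] using this
  subst hwv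
  have := h.cluster (C.part w) (C.part_mem.2 (Finset.mem_univ w))
  rw [hv, Finset.sum_singleton] at this
  rcases h.integral_visit w with h0 | h1
  · linarith
  · exact h1

theorem vectorSpan_polytope :
    vectorSpan ℝ (polytope D C) = vectorSpan ℝ {p : (Edge T D → ℝ) × (T → ℝ) | IsFeasible C p.1 p.2} := by
  rw [← direction_affineSpan, polytope, affineSpan_convexHull, direction_affineSpan]

theorem vectorSpan_polytope_le : vectorSpan ℝ (polytope D C) ≤ LinearMap.ker (equations D C) := by
  rw [vectorSpan_polytope, vectorSpan, Submodule.span_le]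
  rintro _ ⟨p, hp, q, hq, rfl⟩
  simp only [Set.mem_ofPred_eq] at hp hq
  simp only [SetLike.mem_coe, LinearMap.mem_ker, vsub_eq_sub, map_sub, sub_eq_zero]
  ext i
  · simp [equations, hp.degree, hq.degree]
  · simp [equations, hp.visit_eq_one i.2, hq.visit_eq_one i.2]

theorem sub_mem_vectorSpan {x x' : Edge T D → ℝ} {y y' : T → ℝ} (h : IsFeasible C x y)
    (h' : IsFeasible C x' y') : (x - x', y - y') ∈ vectorSpan ℝ (polytope D C) := by
  rw [vectorSpan_polytope]
  exact vsub_mem_vectorSpan ℝ (p₁ := (x, y)) (p₂ := (x', y')) h h'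

-- Each edge is traded for the edges from a to its target endpoints. A target edge comes from a
-- merge; a depot edge comes from moving a round trip, halved because round trips have value 2.
open Classical in
theorem exchange_mem_vectorSpan (a : D) (e : Edge T D) :
    ((Pi.single e 1 - ∑ t, if e ∈ cut (targets D {t}) then Pi.single (depotEdge a t) 1 else 0, 0) :
      (Edge T D → ℝ) × (T → ℝ)) ∈ vectorSpan ℝ (polytope D C) := by
  obtain ⟨j, k, h, rfl⟩ | ⟨b, t, rfl⟩ := e.cases
  · have := sub_mem_vectorSpan (isFeasible_merge (C := C) a j k h)
      (isFeasible_star_one (C := C) fun _ => a)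
    convert this using 2
    · rw [add_sub_cancel_left, mergeVector, sub_sub]
      congr 1
      · congr!
      · rw [Finset.sum_eq_add j k h]
        · simp only [targetEdge_mem_cut, Set.mem_singleton_iff, h, h.symm, not_false_iff, and_true,
            true_or, or_true, if_true]
          congr!
        · rintro t - ⟨hj, hk⟩
          simp [targetEdge_mem_cut, hj.symm, hk.symm]
        · simp
        · simp
    · simp
  · have := Submodule.smul_mem _ (1 / 2 : ℝ) (sub_mem_vectorSpan
      (isFeasible_star_one (C := C) (Function.update (fun _ => a) t b))
      (isFeasible_star_one (C := C) fun _ => a))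
    convert this using 1
    ext e
    · obtain ⟨l, m, hlm, rfl⟩ | ⟨c, s, rfl⟩ := e.cases
      · simp [depotEdge_mem_cut, star_targetEdge, targetEdge_ne_depotEdge]
      · simp only [depotEdge_mem_cut, Set.mem_singleton_iff, Finset.sum_ite_eq,
          Finset.mem_univ, if_true, Pi.sub_apply, Prod.smul_fst, Pi.smul_apply, star_depotEdge,
          Pi.single_apply, depotEdge_inj, Function.update_apply, Pi.one_apply, smul_eq_mul]
        grind
    · simp

open Classical in
theorem visit_mem_vectorSpan (a : D) {t : T} (ht : t ∉ singletonTargets C) :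
    ((Pi.single (depotEdge a t) 2, Pi.single t 1) : (Edge T D → ℝ) × (T → ℝ)) ∈
      vectorSpan ℝ (polytope D C) := by
  have := sub_mem_vectorSpan (isFeasible_star_one (C := C) fun _ => a)
    (isFeasible_star_update (fun _ => a) ht)
  convert this using 2
  · ext e
    obtain ⟨l, m, hlm, rfl⟩ | ⟨c, s, rfl⟩ := e.cases
    · simp [star_targetEdge, targetEdge_ne_depotEdge]
    · simp only [Pi.sub_apply, star_depotEdge, Pi.single_apply, depotEdge_inj,
        Function.update_apply, Pi.one_apply]
      grind
  · ext s
    simp only [Pi.sub_apply, Pi.single_apply, Function.update_apply, Pi.one_apply]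
    split_ifs <;> simp

theorem ker_equations_le [Nonempty D] :
    LinearMap.ker (equations D C) ≤ vectorSpan ℝ (polytope D C) := by
  classical
  obtain ⟨a⟩ := ‹Nonempty D›
  rintro ⟨x, y⟩ h
  have hdeg (i : T) : edgeSum x (cut (targets D {i})) = 2 * y i :=
    sub_eq_zero.1 (congrFun (congrArg Prod.fst h) i)
  have hy (w : T) (hw : w ∈ singletonTargets C) : y w = 0 :=
    congrFun (congrArg Prod.snd h) ⟨w, hw⟩
  have key : (x, y) =
      ∑ e, x e • ((Pi.single e 1 - ∑ t, if e ∈ cut (targets D {t}) then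
        Pi.single (depotEdge a t) 1 else 0, 0) : (Edge T D → ℝ) × (T → ℝ)) +
      ∑ t, y t • ((Pi.single (depotEdge a t) 2, Pi.single t 1) :
        (Edge T D → ℝ) × (T → ℝ)) := by
    -- Grouped by target, the traded edges put x(δ(t)) on the edge from a to t; the degree equation
    -- makes this 2 y_t, which the visit vectors restore.
    have hx : ∑ e, x e • (∑ t, if e ∈ cut (targets D {t}) then
        (Pi.single (depotEdge a t) 1 : Edge T D → ℝ) else 0) =
        ∑ t, y t • Pi.single (depotEdge a t) 2 := by
      simp only [Finset.smul_sum]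
      rw [Finset.sum_comm]
      refine Finset.sum_congr rfl fun t _ => ?_
      have h2 : (Pi.single (depotEdge a t) 2 : Edge T D → ℝ) =
          (2 : ℝ) • Pi.single (depotEdge a t) 1 := by
        rw [← Pi.single_smul]
        simp
      rw [h2, smul_smul, mul_comm, ← hdeg, edgeSum_eq_sum_ite, Finset.sum_smul]
      refine Finset.sum_congr rfl fun e _ => ?_
      split_ifs <;> simp
    ext1
    · simp only [Prod.fst_add, Prod.fst_sum, Prod.smul_fst, smul_sub, Finset.sum_sub_distrib, hx,
        sub_add_cancel]
      exact pi_eq_sum_univ' x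
    · simp only [Prod.snd_add, Prod.snd_sum, Prod.smul_snd, smul_zero, Finset.sum_const_zero,
        zero_add]
      exact pi_eq_sum_univ' y
  rw [key]
  refine Submodule.add_mem _ (Submodule.sum_mem _ fun e _ =>
    Submodule.smul_mem _ _ (exchange_mem_vectorSpan a e)) (Submodule.sum_mem _ fun t _ => ?_)
  -- No visit vector is available for t ∈ W, but there its coefficient vanishes.
  by_cases ht : t ∈ singletonTargets C
  · simp [hy t ht]
  · exact Submodule.smul_mem _ _ (visit_mem_vectorSpan a ht)

end Dimension

end GMDTSP

theorem mainTheorem8 {T D : Type*} [Fintype T] [DecidableEq T] [Fintype D] [Nonempty D]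
    (C : Finpartition (Finset.univ : Finset T)) :
    (GMDTSP.polytope D C).Nonempty ∧
      (Module.finrank ℝ (vectorSpan ℝ (GMDTSP.polytope D C)) : ℤ) =
        ((Fintype.card T).choose 2 : ℤ) + (Fintype.card T : ℤ) * (Fintype.card D : ℤ)
          - ((GMDTSP.singletonTargets C).card : ℤ) := by
  classical
  constructor
  · obtain ⟨a⟩ := ‹Nonempty D›
    exact ⟨(GMDTSP.star (fun _ => a) 1, 1),
      subset_convexHull ℝ _ (GMDTSP.isFeasible_star_one (C := C) fun _ => a)⟩
  · have h := GMDTSP.finrank_ker_equations (D := D) (C := C)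
    rw [GMDTSP.card_edge] at h
    rw [le_antisymm GMDTSP.vectorSpan_polytope_le GMDTSP.ker_equations_le]
    push_cast [← Nat.cast_inj (R := ℤ)] at h
    linarith
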